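/- Let $\mathcal H$ be a separable complex Hilbert space and $S(\mathcal H)$ its complete lattice of closed subspaces; $P^K$ is the orthogonal projection onto $K\in S(\mathcal H)$. An observable is a map $r:\mathcal B(\mathbb R)\to S(\mathcal H)$ on the Borel sets with $r(\emptyset)=0$, $r(\mathbb R)=\mathcal H$, $r(U)\perp r(V)$ whenever $U\cap V=\emptyset$, and $r(\bigcup_n U_n)=\bigvee_n r(U_n)$ for every sequence of Borel sets. It is bounded if $r([-a,a])=\mathcal H$ for some $a>0$. Its spectrum $\mathrm{Spec}(r)$ is the intersection of all closed $C\subseteq\mathbb R$ with $r(C)=\mathcal H$; put $m=\inf\mathrm{Spec}(r)$ and $M=\sup\mathrm{Spec}(r)$ (read as $0$ in the degenerate case $\mathcal H=0$, where the spectrum is empty). For bounded $r$, $A_r$ denotes the corresponding bounded self-adjoint operator $\int t\,dP^{r}(t)$, i.e. the unique one with $\langle x, A_r x\rangle=\int t\,d\langle x,P^{r(t)}x\rangle$ for all $x\in\mathcal H$. A partial density operator is a positive trace class operator $f$ on $\mathcal H$ with $\mathrm{tr}(f)\le 1$. It defines a partial state $G(f):S(\mathcal H)\to[0,1]$ by $G(f)(K)=\mathrm{tr}(P^Kf)$;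 here a partial state is a map $p:S(\mathcal H)\to[0,1]$ with $p(0)=0$, $p(\mathcal H)\le1$ and $p(\bigvee_n A_n)=\sum_n p(A_n)$ for every sequence of mutually orthogonal closed subspaces. For a partial state $p$, let $Q^r_p$ be the Borel measure $U\mapsto p(r(U))$ on $\mathbb R$, let $E_0(r|p)=\int_{[m,M]} t\,dQ^r_p(t)$, and let $E(r|p)=E_0(r|p)+(1-Q^r_p(\mathbb R))\,[m,M]$ (interval arithmetic). Let $r$ be a bounded observable and $f$ a partial density operator. Then: (1) The integral defining $E_0(r|G(f))$ exists, $A_rf$ is of trace class, its trace $\mathrm{tr}(A_rf)=\sum_i\langle e_i,A_rf e_i\rangle$ is an unconditionally convergent sum with the same value for every orthonormal basis $(e_i)$ of $\mathcal H$, and $$E_0(r\mid G(f))=\int_{[m,M]} t\,dQ^r_{G(f)}(t)=\mathrm{tr}(A_rf).$$ (2) Consequently $$E(r\mid G(f))=\mathrm{tr}(A_rf)+(1-\mathrm{tr}(f))\,[m,M].$$ -/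

import Mathlib

open MeasureTheory
open scoped Pointwise

namespace QuantumLogic

variable {H : Type*} [NormedAddCommGroup H] [InnerProductSpace ℂ H] [CompleteSpace H]

/-! ### Quantum events: closed subspaces and their projections -/

/-- The orthogonal projection `P^K` onto the closed subspace `K`. -/
noncomputable def proj (K : ClosedSubmodule ℂ H) : H →L[ℂ] H :=
  K.toSubmodule.starProjection

/-- Mutual orthogonality of a sequence of closed subspaces. -/
def MutuallyOrthogonal (A : ℕ → ClosedSubmodule ℂ H) : Prop :=
  Pairwise fun i j => (A i).toSubmodule ⟂ (A j).toSubmodule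

theorem inner_proj (K : ClosedSubmodule ℂ H) (x : H) :
    inner ℂ x (proj K x) = ((‖proj K x‖ ^ 2 : ℝ) : ℂ) := by
  have h1 : inner ℂ (proj K x) (x - proj K x) = 0 :=
    Submodule.inner_right_of_mem_orthogonal
      (Submodule.starProjection_apply_mem K.toSubmodule x)
      (Submodule.sub_starProjection_mem_orthogonal (K := K.toSubmodule) x)
  rw [inner_sub_right, sub_eq_zero] at h1
  rw [← inner_conj_symm, h1, inner_self_eq_norm_sq_to_K]
  simp

theorem norm_proj_le (K : ClosedSubmodule ℂ H) (x : H) : ‖proj K x‖ ≤ ‖x‖ :=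
  Submodule.norm_starProjection_apply_le _ x

theorem proj_bot (x : H) : proj (⊥ : ClosedSubmodule ℂ H) x = 0 := by
  have h : proj (⊥ : ClosedSubmodule ℂ H) x ∈ (⊥ : Submodule ℂ H) :=
    Submodule.starProjection_apply_mem (⊥ : ClosedSubmodule ℂ H).toSubmodule x
  exact (Submodule.mem_bot ℂ).1 h

theorem proj_top (x : H) : proj (⊤ : ClosedSubmodule ℂ H) x = x := by
  refine Submodule.starProjection_eq_self_iff.2 ?_
  trivial

/-- Pythagoras for countable orthogonal joins. -/
theorem hasSum_norm_sq_proj {A : ℕ → ClosedSubmodule ℂ H} (hA : MutuallyOrthogonal A) (x : H) :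
    HasSum (fun n => ‖proj (A n) x‖ ^ 2) (‖proj (⨆ n, A n) x‖ ^ 2) := by
  have hO : OrthogonalFamily ℂ (fun n => (A n).toSubmodule)
      (fun n => (A n).toSubmodule.subtypeₗᵢ) :=
    OrthogonalFamily.of_pairwise hA
  let v : ∀ n, (A n).toSubmodule := fun n =>
    ⟨proj (A n) x, Submodule.starProjection_apply_mem (A n).toSubmodule x⟩
  have hv : ∀ n, ((A n).toSubmodule.subtypeₗᵢ (v n)) = proj (A n) x := fun n => rfl
  have hb : ∀ s : Finset ℕ, ∑ n ∈ s, ‖v n‖ ^ 2 ≤ ‖x‖ ^ 2 := by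
    intro s
    have h1 := hO.norm_sum v s
    have h2 : inner ℂ x (∑ n ∈ s, (A n).toSubmodule.subtypeₗᵢ (v n))
        = ((∑ n ∈ s, ‖v n‖ ^ 2 : ℝ) : ℂ) := by
      rw [inner_sum, Complex.ofReal_sum]
      exact Finset.sum_congr rfl fun n _ => inner_proj (A n) x
    have h3 := norm_inner_le_norm (𝕜 := ℂ) x (∑ n ∈ s, (A n).toSubmodule.subtypeₗᵢ (v n))
    have h0 : 0 ≤ ∑ n ∈ s, ‖v n‖ ^ 2 := Finset.sum_nonneg fun _ _ => by positivity
    rw [h2, Complex.norm_real, Real.norm_of_nonneg h0] at h3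
    nlinarith [norm_nonneg x, norm_nonneg (∑ n ∈ s, (A n).toSubmodule.subtypeₗᵢ (v n)),
      sq_nonneg (‖x‖ - ‖∑ n ∈ s, (A n).toSubmodule.subtypeₗᵢ (v n)‖)]
  have hs : Summable fun n => ‖v n‖ ^ 2 := summable_of_sum_le (fun _ => by positivity) hb
  have hs' := ((hO.summable_iff_norm_sq_summable v).2 hs).hasSum
  set w := ∑' n, (A n).toSubmodule.subtypeₗᵢ (v n) with hw
  have hwP : proj (⨆ n, A n) x = w := by
    refine Submodule.eq_starProjection_of_mem_of_inner_eq_zero (K := (⨆ n, A n).toSubmodule)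
      ?_ ?_
    · refine (⨆ n, A n).isClosed.mem_of_tendsto hs' (Filter.Eventually.of_forall fun s => ?_)
      exact Submodule.sum_mem (⨆ n, A n).toSubmodule fun n _ =>
        (le_iSup A n : A n ≤ ⨆ n, A n) (v n).2
    · intro u hu
      let N : ClosedSubmodule ℂ H := ⟨(ℂ ∙ (x - w))ᗮ, Submodule.isClosed_orthogonal _⟩
      have hle : (⨆ n, A n) ≤ N := by
        refine iSup_le fun n y hy => ?_
        change y ∈ (ℂ ∙ (x - w))ᗮ
        rw [Submodule.mem_orthogonal_singleton_iff_inner_left]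
        have e1 : inner ℂ y w = inner ℂ y (proj (A n) x) := by
          have h4 := hs'.mapL (innerSL ℂ y)
          have h5 : HasSum (fun m => innerSL ℂ y ((A m).toSubmodule.subtypeₗᵢ (v m)))
              (innerSL ℂ y ((A n).toSubmodule.subtypeₗᵢ (v n))) :=
            hasSum_single n fun m hm =>
              Submodule.isOrtho_iff_inner_eq.1 (hA hm.symm) y hy _ (v m).2
          exact h4.unique h5
        have e2 : inner ℂ y (x - proj (A n) x) = 0 :=
          Submodule.inner_right_of_mem_orthogonal hy
            (Submodule.sub_starProjection_mem_orthogonal (K := (A n).toSubmodule) x)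
        rw [inner_sub_right, e1, ← inner_sub_right, e2]
      have h6 : u ∈ (ℂ ∙ (x - w))ᗮ := hle hu
      rw [Submodule.mem_orthogonal_singleton_iff_inner_right] at h6
      exact h6
  have h7 := (hs'.mapL (innerSL ℂ x)).mapL Complex.reCLM
  have e3 : Complex.reCLM (innerSL ℂ x w) = ‖proj (⨆ n, A n) x‖ ^ 2 := by
    rw [← hwP]
    change (inner ℂ x (proj (⨆ n, A n) x)).re = _
    rw [inner_proj, Complex.ofReal_re]
  rw [e3] at h7
  have e4 : (fun n => Complex.reCLM (innerSL ℂ x ((A n).toSubmodule.subtypeₗᵢ (v n))))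
      = fun n => ‖proj (A n) x‖ ^ 2 := by
    funext n
    change (inner ℂ x (proj (A n) x)).re = _
    rw [inner_proj, Complex.ofReal_re]
  rwa [e4] at h7

/-! ### Partial states -/

/-- A partial state: a subprobability measure on the lattice of closed subspaces. -/
structure PartialState (H : Type*) [NormedAddCommGroup H] [InnerProductSpace ℂ H]
    [CompleteSpace H] where
  toFun : ClosedSubmodule ℂ H → ℝ
  mem_Icc : ∀ K, toFun K ∈ Set.Icc (0 : ℝ) 1
  map_bot : toFun ⊥ = 0
  map_top_le : toFun ⊤ ≤ 1
  map_iSup : ∀ A : ℕ → ClosedSubmodule ℂ H, MutuallyOrthogonal A →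
    HasSum (fun n => toFun (A n)) (toFun (⨆ n, A n))

instance : CoeFun (PartialState H) fun _ => ClosedSubmodule ℂ H → ℝ := ⟨PartialState.toFun⟩

/-! ### Observables -/

/-- An observable: a map from the Borel subsets of the line to the closed subspaces. Values on
non-measurable sets are fixed to be `⊥`, so that an observable is determined by its values on
Borel sets. -/
structure Observable (H : Type*) [NormedAddCommGroup H] [InnerProductSpace ℂ H]
    [CompleteSpace H] where
  toFun : Set ℝ → ClosedSubmodule ℂ H
  not_measurable : ∀ U, ¬ MeasurableSet U → toFun U = ⊥
  map_empty : toFun ∅ = ⊥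
  map_univ : toFun Set.univ = ⊤
  orthogonal : ∀ U V, MeasurableSet U → MeasurableSet V → U ∩ V = ∅ →
    (toFun U).toSubmodule ⟂ (toFun V).toSubmodule
  map_iUnion : ∀ U : ℕ → Set ℝ, (∀ n, MeasurableSet (U n)) →
    toFun (⋃ n, U n) = ⨆ n, toFun (U n)

instance : CoeFun (Observable H) fun _ => Set ℝ → ClosedSubmodule ℂ H := ⟨Observable.toFun⟩

namespace Observable

/-- The observable `r` is bounded if `r([-a, a])` is the whole space for some `a > 0`. -/
def IsBounded (r : Observable H) : Prop := ∃ a : ℝ, 0 < a ∧ r (Set.Icc (-a) a) = ⊤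

/-- The spectrum of `r`: the intersection of all closed sets `C` with `r(C) = H`. -/
def spec (r : Observable H) : Set ℝ := ⋂₀ {C : Set ℝ | IsClosed C ∧ r C = ⊤}

/-- `m = inf Spec(r)`. -/
noncomputable def lower (r : Observable H) : ℝ := sInf r.spec

/-- `M = sup Spec(r)`. -/
noncomputable def upper (r : Observable H) : ℝ := sSup r.spec

theorem mutuallyOrthogonal (r : Observable H) {U : ℕ → Set ℝ} (hU : ∀ n, MeasurableSet (U n))
    (hd : Pairwise (Function.onFun Disjoint U)) : MutuallyOrthogonal fun n => r (U n) :=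
  fun i j hij => r.orthogonal _ _ (hU i) (hU j) (Set.disjoint_iff_inter_eq_empty.1 (hd hij))

/-- The Borel measure `U ↦ q(r(U))` for a nonnegative, orthogonally countably additive function
`q` of closed subspaces. -/
noncomputable def compMeasure (r : Observable H) (q : ClosedSubmodule ℂ H → ℝ)
    (hq : ∀ K, 0 ≤ q K) (h0 : q ⊥ = 0)
    (hadd : ∀ A : ℕ → ClosedSubmodule ℂ H, MutuallyOrthogonal A →
      HasSum (fun n => q (A n)) (q (⨆ n, A n))) : Measure ℝ :=
  Measure.ofMeasurable (fun U _ => ENNReal.ofReal (q (r U)))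
    (by rw [r.map_empty, h0, ENNReal.ofReal_zero])
    (by
      intro U hU hd
      have h := hadd _ (r.mutuallyOrthogonal hU hd)
      rw [r.map_iUnion U hU, ← h.tsum_eq, ENNReal.ofReal_tsum_of_nonneg (fun n => hq _) h.summable])

theorem compMeasure_apply (r : Observable H) (q : ClosedSubmodule ℂ H → ℝ)
    (hq : ∀ K, 0 ≤ q K) (h0 : q ⊥ = 0)
    (hadd : ∀ A : ℕ → ClosedSubmodule ℂ H, MutuallyOrthogonal A →
      HasSum (fun n => q (A n)) (q (⨆ n, A n))) {U : Set ℝ} (hU : MeasurableSet U) :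
    r.compMeasure q hq h0 hadd U = ENNReal.ofReal (q (r U)) :=
  Measure.ofMeasurable_apply U hU

/-- The subprobability distribution `Q^r_p = p ∘ r` on the line. -/
noncomputable def distribution (r : Observable H) (p : PartialState H) : Measure ℝ :=
  r.compMeasure p (fun K => (p.mem_Icc K).1) p.map_bot p.map_iSup

/-- `E₀(r | p) = ∫_m^M t dQ^r_p(t)`, the integral over the closed interval `[m, M]`. -/
noncomputable def expect₀ (r : Observable H) (p : PartialState H) : ℝ :=
  ∫ t in Set.Icc r.lower r.upper, t ∂(r.distribution p)

/-- The expected value `E(r | p) = E₀(r | p) + (1 - Q^r_p(ℝ)) [m, M]`, as a set of reals. -/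
noncomputable def expect (r : Observable H) (p : PartialState H) : Set ℝ :=
  {r.expect₀ p} + (1 - (r.distribution p).real Set.univ) • Set.Icc r.lower r.upper

/-! ### The self-adjoint operator of a bounded observable -/

/-- The spectral measure `U ↦ ⟨x, P^{r(U)} x⟩ = ‖P^{r(U)} x‖²` of the vector `x`. -/
noncomputable def vectorMeasure (r : Observable H) (x : H) : Measure ℝ :=
  r.compMeasure (fun K => ‖proj K x‖ ^ 2) (fun _ => by positivity) (by simp [proj_bot])
    (fun _ hA => hasSum_norm_sq_proj hA x)

theorem vectorMeasure_apply (r : Observable H) (x : H) {U : Set ℝ} (hU : MeasurableSet U) :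
    r.vectorMeasure x U = ENNReal.ofReal (‖proj (r U) x‖ ^ 2) :=
  r.compMeasure_apply _ _ _ _ hU

/-- `A = ∫ t dP^r(t)`: the bounded operator `A` is self-adjoint and
`⟨x, A x⟩ = ∫ t d⟨x, P^{r(t)} x⟩` for every vector `x`. -/
def IsOperator (r : Observable H) (A : H →L[ℂ] H) : Prop :=
  IsSelfAdjoint A ∧ ∀ x : H, Integrable (fun t : ℝ => t) (r.vectorMeasure x) ∧
    inner ℂ x (A x) = ((∫ t, t ∂(r.vectorMeasure x) : ℝ) : ℂ)

instance (r : Observable H) (x : H) : IsFiniteMeasure (r.vectorMeasure x) :=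
  ⟨by rw [vectorMeasure_apply r x MeasurableSet.univ]; exact ENNReal.ofReal_lt_top⟩

theorem mono (r : Observable H) {U V : Set ℝ} (hU : MeasurableSet U) (hV : MeasurableSet V)
    (h : U ⊆ V) : r U ≤ r V := by
  have h1 : V = ⋃ n : ℕ, if n = 0 then U else V := by
    ext t
    simp only [Set.mem_iUnion]
    constructor
    · intro ht
      exact ⟨1, by simpa using ht⟩
    · rintro ⟨n, hn⟩
      split_ifs at hn
      exacts [h hn, hn]
  have h2 := r.map_iUnion (fun n : ℕ => if n = 0 then U else V)
    (by intro n; split_ifs <;> assumption)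
  rw [← h1] at h2
  rw [h2]
  exact le_iSup (fun n : ℕ => r (if n = 0 then U else V)) 0

theorem vectorMeasure_compl (r : Observable H) {a : ℝ} (ha : r (Set.Icc (-a) a) = ⊤) (x : H) :
    ∀ᵐ t ∂(r.vectorMeasure x), t ∈ Set.Icc (-a) a := by
  have h0 : r (Set.Icc (-a) a)ᶜ = ⊥ := by
    have h := r.orthogonal _ _ measurableSet_Icc.compl measurableSet_Icc
      (Set.compl_inter_self (Set.Icc (-a) a))
    rw [ha] at h
    refine le_bot_iff.1 fun y hy => ?_
    have h3 := Submodule.isOrtho_iff_inner_eq.1 h y hy y trivial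
    simpa using h3
  rw [ae_iff]
  change r.vectorMeasure x (Set.Icc (-a) a)ᶜ = 0
  rw [vectorMeasure_apply r x measurableSet_Icc.compl, h0, proj_bot]
  simp

theorem integrable_id_vectorMeasure (r : Observable H) {a : ℝ} (ha : r (Set.Icc (-a) a) = ⊤)
    (x : H) : Integrable (fun t : ℝ => t) (r.vectorMeasure x) :=
  Integrable.of_mem_Icc (-a) a measurable_id.aemeasurable (r.vectorMeasure_compl ha x)

/-- Polarization for the projections `P^{r((t, ∞))}`. -/
theorem measurable_inner_proj (r : Observable H) (a : ℝ) (x y : H) :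
    Measurable fun t : ℝ => inner ℂ x (proj (r (Set.Ioi (t - a))) y) := by
  have hq : ∀ z : H, Measurable fun t : ℝ => inner ℂ (proj (r (Set.Ioi (t - a))) z) z := by
    intro z
    have hanti : Antitone fun t : ℝ => ((r.vectorMeasure z) (Set.Ioi (t - a))).toReal := by
      intro t u htu
      exact ENNReal.toReal_mono (measure_ne_top _ _)
        (measure_mono (Set.Ioi_subset_Ioi (by linarith)))
    have he : (fun t : ℝ => inner ℂ (proj (r (Set.Ioi (t - a))) z) z) = fun t : ℝ =>
        ((((r.vectorMeasure z) (Set.Ioi (t - a))).toReal : ℝ) : ℂ) := by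
      funext t
      rw [vectorMeasure_apply r z measurableSet_Ioi, ENNReal.toReal_ofReal (by positivity),
        ← inner_conj_symm, inner_proj, Complex.conj_ofReal]
    rw [he]
    exact Complex.measurable_ofReal.comp hanti.measurable
  have he : (fun t : ℝ => inner ℂ x (proj (r (Set.Ioi (t - a))) y)) = fun t : ℝ =>
      inner ℂ (proj (r (Set.Ioi (t - a))) x) y := by
    funext t
    exact (Submodule.inner_starProjection_left_eq_right _ x y).symm
  rw [he]
  have hp : ∀ t : ℝ, inner ℂ (proj (r (Set.Ioi (t - a))) x) y = _ := fun t =>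
    inner_map_polarization' (proj (r (Set.Ioi (t - a)))).toLinearMap x y
  simp_rw [hp]
  exact ((((hq _).sub (hq _)).sub ((hq _).const_mul _)).add ((hq _).const_mul _)).div_const _

theorem integrable_inner_proj (r : Observable H) (a : ℝ) (x y : H) :
    IntegrableOn (fun t : ℝ => inner ℂ x (proj (r (Set.Ioi (t - a))) y))
      (Set.Ioc 0 (2 * a)) := by
  refine Measure.integrableOn_of_bounded (M := ‖x‖ * ‖y‖) measure_Ioc_lt_top.ne
    (r.measurable_inner_proj a x y).aestronglyMeasurable (Filter.Eventually.of_forall fun t => ?_)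
  exact (norm_inner_le_norm _ _).trans
    (mul_le_mul_of_nonneg_left (norm_proj_le _ _) (norm_nonneg _))

/-- A bounded observable has a bounded self-adjoint operator. -/
theorem exists_isOperator (r : Observable H) (hr : r.IsBounded) : ∃ A, r.IsOperator A := by
  obtain ⟨a, ha0, ha⟩ := hr
  let B₀ : H →ₗ⋆[ℂ] H →ₗ[ℂ] ℂ := LinearMap.mk₂'ₛₗ (starRingEnd ℂ) (RingHom.id ℂ)
    (fun x y => ∫ t in Set.Ioc 0 (2 * a), inner ℂ x (proj (r (Set.Ioi (t - a))) y))
    (fun x x' y => by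
      simp only [inner_add_left]
      exact integral_add (r.integrable_inner_proj a x y) (r.integrable_inner_proj a x' y))
    (fun c x y => by
      simp only [inner_smul_left, smul_eq_mul]
      exact integral_const_mul _ _)
    (fun x y y' => by
      simp only [map_add, inner_add_right]
      exact integral_add (r.integrable_inner_proj a x y) (r.integrable_inner_proj a x y'))
    (fun c x y => by
      simp only [map_smul, inner_smul_right, smul_eq_mul, RingHom.id_apply]
      exact integral_const_mul _ _)
  let B : H →L⋆[ℂ] H →L[ℂ] ℂ := B₀.mkContinuous₂ (2 * a) (fun x y => by
    have h := norm_setIntegral_le_of_norm_le_const (μ := volume) (s := Set.Ioc 0 (2 * a))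
      (f := fun t => inner ℂ x (proj (r (Set.Ioi (t - a))) y)) (C := ‖x‖ * ‖y‖) measure_Ioc_lt_top
      (fun t _ => (norm_inner_le_norm _ _).trans
        (mul_le_mul_of_nonneg_left (norm_proj_le _ _) (norm_nonneg _)))
    have h2 : volume.real (Set.Ioc 0 (2 * a)) = 2 * a := by
      rw [Real.volume_real_Ioc_of_le (by linarith)]; ring
    rw [h2] at h
    calc _ ≤ _ := h
      _ = _ := by ring)
  let A : H →L[ℂ] H := InnerProductSpace.continuousLinearMapOfBilin B -
    (a : ℂ) • ContinuousLinearMap.id ℂ H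
  have hA : ∀ x : H, inner ℂ (A x) x = ((∫ t, t ∂(r.vectorMeasure x) : ℝ) : ℂ) := by
    intro x
    have h1 : inner ℂ (A x) x = (∫ t in Set.Ioc 0 (2 * a),
        inner ℂ x (proj (r (Set.Ioi (t - a))) x)) - (a : ℂ) * ((‖x‖ ^ 2 : ℝ) : ℂ) := by
      simp only [A, sub_apply, inner_sub_left,
        InnerProductSpace.continuousLinearMapOfBilin_apply, smul_apply,
        ContinuousLinearMap.id_apply, inner_smul_left, Complex.conj_ofReal,
        inner_self_eq_norm_sq_to_K]
      simp only [Complex.ofReal_pow]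
      rfl
    have h2 : ∀ t : ℝ, inner ℂ x (proj (r (Set.Ioi (t - a))) x)
        = (((r.vectorMeasure x).real {s | t < s + a} : ℝ) : ℂ) := by
      intro t
      have hs : {s : ℝ | t < s + a} = Set.Ioi (t - a) := by
        ext s; simp [sub_lt_iff_lt_add]
      rw [hs, Measure.real, vectorMeasure_apply r x measurableSet_Ioi,
        ENNReal.toReal_ofReal (by positivity), inner_proj]
    have hint := r.integrable_id_vectorMeasure ha x
    have hae := r.vectorMeasure_compl ha x
    have h3 := Integrable.integral_eq_integral_meas_lt
      (hint.add (integrable_const a)) (by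
        filter_upwards [hae] with s hs
        have := hs.1
        change (0 : ℝ) ≤ s + a
        linarith)
    have h4 : ∫ t in Set.Ioi 0, (r.vectorMeasure x).real {s | t < s + a}
        = ∫ t in Set.Ioc 0 (2 * a), (r.vectorMeasure x).real {s | t < s + a} := by
      refine setIntegral_eq_of_subset_of_forall_sdiff_eq_zero measurableSet_Ioi
        Set.Ioc_subset_Ioi_self ?_
      rintro t ⟨ht, ht'⟩
      have ht2 : 2 * a < t := by
        by_contra hc
        exact ht' ⟨ht, not_lt.1 hc⟩
      have : (r.vectorMeasure x) {s | t < s + a} = 0 := by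
        refine measure_mono_null (fun s hs => ?_) (ae_iff.1 hae)
        intro hc
        have h5 := hc.2
        have h6 : t < s + a := hs
        linarith
      simp [Measure.real, this]
    have h5 : (r.vectorMeasure x).real Set.univ = ‖x‖ ^ 2 := by
      rw [Measure.real, vectorMeasure_apply r x MeasurableSet.univ, r.map_univ, proj_top,
        ENNReal.toReal_ofReal (by positivity)]
    have h6 : ∫ s, (s + a) ∂(r.vectorMeasure x)
        = (∫ s, s ∂(r.vectorMeasure x)) + ‖x‖ ^ 2 * a := by
      rw [integral_add hint (integrable_const a), integral_const, h5, smul_eq_mul]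
    rw [h1]
    simp_rw [h2]
    rw [integral_complex_ofReal, ← h4]
    have h7 : ∫ t in Set.Ioi 0, (r.vectorMeasure x).real {s | t < s + a}
        = (∫ s, s ∂(r.vectorMeasure x)) + ‖x‖ ^ 2 * a := h3.symm.trans h6
    rw [h7]
    push_cast
    ring
  refine ⟨A, ?_, fun x => ⟨r.integrable_id_vectorMeasure ha x, ?_⟩⟩
  · rw [ContinuousLinearMap.isSelfAdjoint_iff_isSymmetric,
      LinearMap.isSymmetric_iff_inner_map_self_real]
    intro x
    change (starRingEnd ℂ) (inner ℂ (A x) x) = inner ℂ (A x) x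
    rw [hA, Complex.conj_ofReal]
  · rw [← inner_conj_symm, hA, Complex.conj_ofReal]

/-- The operator of an observable is unique. -/
theorem isOperator_unique (r : Observable H) {A A' : H →L[ℂ] H} (h : r.IsOperator A)
    (h' : r.IsOperator A') : A = A' := by
  have : A.toLinearMap = A'.toLinearMap := by
    refine (ext_inner_map _ _).1 fun x => ?_
    change inner ℂ (A x) x = inner ℂ (A' x) x
    rw [← inner_conj_symm, (h.2 x).2, ← inner_conj_symm, (h'.2 x).2]
  exact ContinuousLinearMap.coe_injective this

/-- The bounded self-adjoint operator `A_r` corresponding to the bounded observable `r`: the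
unique operator with `IsOperator`. -/
noncomputable def operator (r : Observable H) (hr : r.IsBounded) : H →L[ℂ] H :=
  (r.exists_isOperator hr).choose

theorem operator_spec (r : Observable H) (hr : r.IsBounded) : r.IsOperator (r.operator hr) :=
  (r.exists_isOperator hr).choose_spec

end Observable

/-! ### Trace class operators and partial density operators -/

/-- `T` is of trace class: `∑ ⟨eᵢ, |T| eᵢ⟩ < ∞` for some orthonormal basis. -/
def IsTraceClass (T : H →L[ℂ] H) : Prop :=
  ∃ (s : Set H) (e : HilbertBasis s ℂ H), Summable fun i => (inner ℂ (e i) (CFC.abs T (e i))).re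

/-- The index set of a fixed orthonormal basis of `H`. -/
def basisIndex (H : Type*) [NormedAddCommGroup H] [InnerProductSpace ℂ H] [CompleteSpace H] :
    Set H := (exists_hilbertBasis ℂ H).choose

/-- A fixed orthonormal basis of `H`. -/
noncomputable def stdBasis (H : Type*) [NormedAddCommGroup H] [InnerProductSpace ℂ H]
    [CompleteSpace H] : HilbertBasis (basisIndex H) ℂ H :=
  (exists_hilbertBasis ℂ H).choose_spec.choose

/-- The trace `∑ ⟨eᵢ, T eᵢ⟩` (meaningful for trace class operators, and then independent of the
orthonormal basis). -/
noncomputable def trace (T : H →L[ℂ] H) : ℂ :=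
  ∑' i, inner ℂ (stdBasis H i) (T (stdBasis H i))

/-- A partial density operator: a positive trace class operator with trace at most one. -/
structure PartialDensity (H : Type*) [NormedAddCommGroup H] [InnerProductSpace ℂ H]
    [CompleteSpace H] where
  op : H →L[ℂ] H
  isPositive : op.IsPositive
  isTraceClass : IsTraceClass op
  trace_le_one : (trace op).re ≤ 1

/-- Parseval. -/
theorem hasSum_norm_sq_inner {ι : Type*} (e : HilbertBasis ι ℂ H) (x : H) :
    HasSum (fun i => ‖inner ℂ (e i) x‖ ^ 2) (‖x‖ ^ 2) := by
  have h := (e.hasSum_inner_mul_inner x x).mapL Complex.reCLM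
  have h1 : Complex.reCLM (inner ℂ x x) = ‖x‖ ^ 2 := by
    rw [inner_self_eq_norm_sq_to_K]
    norm_cast
  rw [h1] at h
  have h2 : (fun i => Complex.reCLM (inner ℂ x (e i) * inner ℂ (e i) x))
      = fun i => ‖inner ℂ (e i) x‖ ^ 2 := by
    funext i
    rw [← inner_conj_symm x (e i), mul_comm, Complex.mul_conj, Complex.normSq_eq_norm_sq]
    exact Complex.ofReal_re _
  rwa [h2] at h

/-- `∑ ‖S eᵢ‖² < ∞` does not depend on the basis. -/
theorem summable_norm_sq_of_basis {ι κ : Type*} (b : HilbertBasis ι ℂ H) (e : HilbertBasis κ ℂ H)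
    {S : H →L[ℂ] H} (hS : IsSelfAdjoint S) (h : Summable fun i => ‖S (b i)‖ ^ 2) :
    Summable fun j => ‖S (e j)‖ ^ 2 := by
  have h1 : Summable fun p : ι × κ => ‖inner ℂ (e p.2) (S (b p.1))‖ ^ 2 := by
    refine (summable_prod_of_nonneg fun _ => by positivity).2
      ⟨fun i => (hasSum_norm_sq_inner e (S (b i))).summable, ?_⟩
    simpa only [fun i => (hasSum_norm_sq_inner e (S (b i))).tsum_eq] using h
  have h2 : Summable fun p : κ × ι => ‖inner ℂ (e p.1) (S (b p.2))‖ ^ 2 := h1.prod_symm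
  have h3 := ((summable_prod_of_nonneg fun _ => by positivity).1 h2).2
  refine h3.congr fun j => ?_
  rw [← (hasSum_norm_sq_inner b (S (e j))).tsum_eq]
  refine tsum_congr fun i => ?_
  have h4 : inner ℂ (S (e j)) (b i) = inner ℂ (e j) (S (b i)) :=
    (ContinuousLinearMap.isSelfAdjoint_iff_isSymmetric.1 hS) (e j) (b i)
  rw [← h4, norm_inner_symm]

/-- `tr(T S²) = ∑ ⟨S eⱼ, T S eⱼ⟩` for a Hilbert-Schmidt self-adjoint operator `S`. -/
theorem hasSum_inner_comp_sq {ι : Type*} (e : HilbertBasis ι ℂ H) (T : H →L[ℂ] H)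
    {S : H →L[ℂ] H} (hS : IsSelfAdjoint S) (h : Summable fun i => ‖S (e i)‖ ^ 2) :
    HasSum (fun i => inner ℂ (e i) (T (S (S (e i)))))
      (∑' j, inner ℂ (S (e j)) (T (S (e j)))) := by
  have hsym : ∀ x y : H, inner ℂ (S x) y = inner ℂ x (S y) := fun x y =>
    (ContinuousLinearMap.isSelfAdjoint_iff_isSymmetric.1 hS) x y
  have a1 : Summable fun p : ι × ι => ‖inner ℂ (e p.2) (S (e p.1))‖ ^ 2 := by
    refine (summable_prod_of_nonneg fun _ => by positivity).2
      ⟨fun i => (hasSum_norm_sq_inner e (S (e i))).summable, ?_⟩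
    simpa only [fun i => (hasSum_norm_sq_inner e (S (e i))).tsum_eq] using h
  have a2 : Summable fun p : ι × ι => ‖inner ℂ (e p.1) (T (S (e p.2)))‖ ^ 2 := by
    have : Summable fun p : ι × ι => ‖inner ℂ (e p.2) (T (S (e p.1)))‖ ^ 2 := by
      refine (summable_prod_of_nonneg fun _ => by positivity).2
        ⟨fun i => (hasSum_norm_sq_inner e (T (S (e i)))).summable, ?_⟩
      simp only [fun i => (hasSum_norm_sq_inner e (T (S (e i)))).tsum_eq]
      refine Summable.of_nonneg_of_le (fun _ => by positivity) (fun i => ?_)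
        (h.mul_left (‖T‖ ^ 2))
      rw [← mul_pow]
      exact pow_le_pow_left₀ (norm_nonneg _) (T.le_opNorm _) 2
    exact this.prod_symm
  have hF : Summable fun p : ι × ι =>
      inner ℂ (e p.2) (S (e p.1)) * inner ℂ (e p.1) (T (S (e p.2))) := by
    refine Summable.of_norm_bounded (a1.add a2) fun p => ?_
    rw [norm_mul]
    nlinarith [sq_nonneg (‖inner ℂ (e p.2) (S (e p.1))‖ - ‖inner ℂ (e p.1) (T (S (e p.2)))‖),
      sq_nonneg ‖inner ℂ (e p.2) (S (e p.1))‖, sq_nonneg ‖inner ℂ (e p.1) (T (S (e p.2)))‖]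
  have f1 : ∀ i, HasSum (fun j => inner ℂ (e j) (S (e i)) * inner ℂ (e i) (T (S (e j))))
      (inner ℂ (e i) (T (S (S (e i))))) := by
    intro i
    have := (e.hasSum_repr (S (e i))).mapL ((innerSL ℂ (e i)).comp (T.comp S))
    simpa [e.repr_apply_apply, inner_smul_right] using this
  have f2 : ∀ j, HasSum (fun i => inner ℂ (e j) (S (e i)) * inner ℂ (e i) (T (S (e j))))
      (inner ℂ (S (e j)) (T (S (e j)))) := by
    intro j
    simpa only [hsym] using e.hasSum_inner_mul_inner (S (e j)) (T (S (e j)))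
  have g1 := hF.hasSum.prod_fiberwise f1
  have g2 := (hF.prod_symm.hasSum).prod_fiberwise f2
  have : ∑' p : ι × ι, inner ℂ (e p.2) (S (e p.1)) * inner ℂ (e p.1) (T (S (e p.2)))
      = ∑' p : ι × ι, inner ℂ (e p.swap.2) (S (e p.swap.1)) *
        inner ℂ (e p.swap.1) (T (S (e p.swap.2))) :=
    ((Equiv.prodComm ι ι).tsum_eq (fun p : ι × ι =>
      inner ℂ (e p.2) (S (e p.1)) * inner ℂ (e p.1) (T (S (e p.2))))).symm
  rw [this] at g1
  rw [g2.tsum_eq]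
  exact g1

namespace PartialDensity

theorem nonneg (f : PartialDensity H) : 0 ≤ f.op :=
  (ContinuousLinearMap.nonneg_iff_isPositive f.op).2 f.isPositive

/-- The positive square root of `f`. -/
noncomputable def root (f : PartialDensity H) : H →L[ℂ] H := CFC.sqrt f.op

theorem root_selfAdjoint (f : PartialDensity H) : IsSelfAdjoint f.root :=
  IsSelfAdjoint.of_nonneg (CFC.sqrt_nonneg f.op)

theorem root_root (f : PartialDensity H) (x : H) : f.root (f.root x) = f.op x := by
  have h := CFC.sqrt_mul_sqrt_self f.op f.nonneg
  exact congrArg (fun T : H →L[ℂ] H => T x) h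

theorem inner_op (f : PartialDensity H) (x : H) :
    inner ℂ x (f.op x) = ((‖f.root x‖ ^ 2 : ℝ) : ℂ) := by
  rw [← f.root_root]
  have h : inner ℂ (f.root x) (f.root x) = inner ℂ x (f.root (f.root x)) :=
    (ContinuousLinearMap.isSelfAdjoint_iff_isSymmetric.1 f.root_selfAdjoint) x (f.root x)
  rw [← h, inner_self_eq_norm_sq_to_K]
  norm_cast

theorem summable_root (f : PartialDensity H) {ι : Type*} (e : HilbertBasis ι ℂ H) :
    Summable fun i => ‖f.root (e i)‖ ^ 2 := by
  obtain ⟨s, b, hb⟩ := f.isTraceClass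
  refine summable_norm_sq_of_basis b e f.root_selfAdjoint ?_
  rw [CFC.abs_of_nonneg f.op f.nonneg] at hb
  refine hb.congr fun i => ?_
  rw [f.inner_op, Complex.ofReal_re]

theorem trace_proj (f : PartialDensity H) (K : ClosedSubmodule ℂ H) :
    (trace (proj K ∘L f.op)).re = ∑' j, ‖proj K (f.root (stdBasis H j))‖ ^ 2 := by
  have h := (hasSum_inner_comp_sq (stdBasis H) (proj K) f.root_selfAdjoint
    (f.summable_root _)).tsum_eq
  simp only [f.root_root, inner_proj] at h
  rw [trace]
  simp only [ContinuousLinearMap.comp_apply]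
  rw [h, ← Complex.ofReal_tsum, Complex.ofReal_re]

theorem trace_op (f : PartialDensity H) :
    (trace f.op).re = ∑' j, ‖f.root (stdBasis H j)‖ ^ 2 := by
  rw [trace]
  simp only [f.inner_op]
  rw [← Complex.ofReal_tsum, Complex.ofReal_re]

theorem proj_le (f : PartialDensity H) (K : ClosedSubmodule ℂ H) (j : basisIndex H) :
    ‖proj K (f.root (stdBasis H j))‖ ^ 2 ≤ ‖f.root (stdBasis H j)‖ ^ 2 :=
  pow_le_pow_left₀ (norm_nonneg _) (norm_proj_le _ _) 2

theorem summable_proj (f : PartialDensity H) (K : ClosedSubmodule ℂ H) :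
    Summable fun j => ‖proj K (f.root (stdBasis H j))‖ ^ 2 :=
  Summable.of_nonneg_of_le (fun _ => by positivity) (f.proj_le K) (f.summable_root _)

/-- The partial state `G(f)` of the partial density operator `f`: `G(f)(K) = tr(P^K f)`. -/
noncomputable def toPartialState (f : PartialDensity H) : PartialState H where
  toFun K := (trace (proj K ∘L f.op)).re
  mem_Icc K := by
    rw [f.trace_proj]
    refine ⟨tsum_nonneg fun _ => by positivity, le_trans ?_ f.trace_le_one⟩
    rw [f.trace_op]
    exact (f.summable_proj K).tsum_le_tsum (f.proj_le K) (f.summable_root _)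
  map_bot := by
    rw [f.trace_proj]
    simp [proj_bot]
  map_top_le := by
    rw [f.trace_proj]
    simp only [proj_top]
    rw [← f.trace_op]
    exact f.trace_le_one
  map_iSup A hA := by
    simp only [f.trace_proj]
    have h1 : ∀ j, HasSum (fun n => ‖proj (A n) (f.root (stdBasis H j))‖ ^ 2)
        (‖proj (⨆ n, A n) (f.root (stdBasis H j))‖ ^ 2) := fun j => hasSum_norm_sq_proj hA _
    have h2 : Summable fun p : basisIndex H × ℕ =>
        ‖proj (A p.2) (f.root (stdBasis H p.1))‖ ^ 2 := by
      refine (summable_prod_of_nonneg fun _ => by positivity).2 ⟨fun j => (h1 j).summable, ?_⟩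
      simpa only [fun j => (h1 j).tsum_eq] using f.summable_proj (⨆ n, A n)
    have g1 := h2.hasSum.prod_fiberwise h1
    have g2 := h2.prod_symm.hasSum.prod_fiberwise fun n => (f.summable_proj (A n)).hasSum
    have h3 := (Equiv.prodComm ℕ (basisIndex H)).tsum_eq (fun p : basisIndex H × ℕ =>
      ‖proj (A p.2) (f.root (stdBasis H p.1))‖ ^ 2)
    rw [g1.tsum_eq, ← h3]
    exact g2

end PartialDensity

end QuantumLogic

namespace QuantumLogic

variable {H : Type*} [NormedAddCommGroup H] [InnerProductSpace ℂ H] [CompleteSpace H]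

/-! ### Distribution of a bounded observable and its support. -/

namespace Observable

/-! Let `S = √f`, which is Hilbert–Schmidt because `f` is trace class, and let `(b_j)` be the fixed
basis. For every bounded `T`, cyclicity gives `tr(T f) = ∑ ⟨S b_j, T S b_j⟩`. Taking `T = P^{r(U)}`
shows that the distribution of `r` is the sum of the spectral measures of the vectors `S b_j`
(`distribution_toPartialState`). Taking `T = A_r` (`trace_comp`), the defining property of `A_r`
turns each term into the integral of `t` against the spectral measure of `S b_j`. Integrating `t`
term by term against the sum of measures identifies the two sides.

The integral exists because the distribution is finite and lives on the compact interval `[m, M]`.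
Independence of the basis is a Fubini argument for a double series indexed by two bases
(`hasSum_inner_comp_sq_of_basis`). The trace class property follows from `|T f| ≤ ‖T‖ f`
(`abs_comp_le`), an instance of operator monotonicity of the square root. The interval formula then
only needs that the total mass of the distribution is `tr f`. -/

theorem map_compl_eq_bot (r : Observable H) {C : Set ℝ} (hC : MeasurableSet C) (h : r C = ⊤) :
    r Cᶜ = ⊥ := by
  have ho := r.orthogonal _ _ hC.compl hC (Set.compl_inter_self C)
  rw [h] at ho
  refine le_bot_iff.1 fun y hy => ?_
  have hy0 := Submodule.isOrtho_iff_inner_eq.1 ho y hy y trivial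
  simpa using hy0

theorem distribution_apply (r : Observable H) (p : PartialState H) {U : Set ℝ}
    (hU : MeasurableSet U) : r.distribution p U = ENNReal.ofReal (p (r U)) :=
  r.compMeasure_apply _ _ _ _ hU

instance (r : Observable H) (p : PartialState H) : IsFiniteMeasure (r.distribution p) :=
  ⟨by rw [r.distribution_apply p MeasurableSet.univ]; exact ENNReal.ofReal_lt_top⟩

/-- Boundedness puts the spectrum inside `[-a, a]`, so `sInf` and `sSup` are true bounds and not
default values; if the spectrum is empty the inclusion is vacuous. -/
theorem spec_subset_Icc (r : Observable H) (hr : r.IsBounded) :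
    r.spec ⊆ Set.Icc r.lower r.upper := by
  obtain ⟨a, -, ha⟩ := hr
  have hs : r.spec ⊆ Set.Icc (-a) a := Set.sInter_subset_of_mem ⟨isClosed_Icc, ha⟩
  exact subset_Icc_csInf_csSup (bddBelow_Icc.mono hs) (bddAbove_Icc.mono hs)

/-- The complement of the spectrum is a possibly uncountable union of open null sets; since the line
is second countable, countably many of them already cover it. -/
theorem distribution_compl_spec (r : Observable H) (p : PartialState H) :
    r.distribution p r.specᶜ = 0 := by
  obtain ⟨T, hTc, hTs, hT⟩ := TopologicalSpace.isOpen_sUnion_countable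
    (compl '' {C : Set ℝ | IsClosed C ∧ r C = ⊤})
    (by rintro _ ⟨C, hC, rfl⟩; exact hC.1.isOpen_compl)
  rw [spec, Set.compl_sInter, ← hT]
  refine (measure_sUnion_null_iff hTc).2 fun U hU => ?_
  obtain ⟨C, hC, rfl⟩ := hTs hU
  rw [r.distribution_apply p hC.1.measurableSet.compl,
    r.map_compl_eq_bot hC.1.measurableSet hC.2, p.map_bot, ENNReal.ofReal_zero]

/-- The distribution of a bounded observable is concentrated on `[m, M]`. -/
theorem ae_distribution_mem_Icc (r : Observable H) (hr : r.IsBounded) (p : PartialState H) :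
    ∀ᵐ t ∂(r.distribution p), t ∈ Set.Icc r.lower r.upper :=
  measure_mono_null (Set.compl_subset_compl.2 (r.spec_subset_Icc hr)) (r.distribution_compl_spec p)

theorem integrable_id_distribution (r : Observable H) (hr : r.IsBounded) (p : PartialState H) :
    Integrable (fun t : ℝ => t) (r.distribution p) :=
  Integrable.of_mem_Icc _ _ measurable_id.aemeasurable (r.ae_distribution_mem_Icc hr p)

theorem expect₀_eq_integral (r : Observable H) (hr : r.IsBounded) (p : PartialState H) :
    r.expect₀ p = ∫ t, t ∂(r.distribution p) := by
  rw [expect₀, Measure.restrict_eq_self_of_ae_mem (r.ae_distribution_mem_Icc hr p)]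

/-- The distribution of `r` in the state of `f` is the sum of the spectral measures of the
vectors `√f eⱼ`. -/
theorem distribution_toPartialState (r : Observable H) (f : PartialDensity H) :
    r.distribution f.toPartialState =
      Measure.sum fun j => r.vectorMeasure (f.root (stdBasis H j)) := by
  ext U hU
  rw [r.distribution_apply _ hU, Measure.sum_apply _ hU]
  change ENNReal.ofReal (trace (proj (r U) ∘L f.op)).re = _
  rw [f.trace_proj, ENNReal.ofReal_tsum_of_nonneg (fun _ => by positivity) (f.summable_proj _)]
  exact tsum_congr fun j => (r.vectorMeasure_apply _ hU).symm

/-- Since `r(ℝ)` is the whole space, its projection is the identity. This is the weight of the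
interval in part (2). -/
theorem distribution_toPartialState_univ (r : Observable H) (f : PartialDensity H) :
    (r.distribution f.toPartialState).real Set.univ = (trace f.op).re := by
  have h : f.toPartialState (r Set.univ) = (trace f.op).re := by
    change (trace (proj (r Set.univ) ∘L f.op)).re = _
    rw [f.trace_proj, f.trace_op, r.map_univ]
    simp only [proj_top]
  rw [Measure.real, r.distribution_apply _ MeasurableSet.univ,
    ENNReal.toReal_ofReal (f.toPartialState.mem_Icc _).1, h]

end Observable

/-! ### The trace of `T f` in an arbitrary orthonormal basis. -/

/-- `∑ ⟨eᵢ, T S² eᵢ⟩ = ∑ ⟨S bⱼ, T S bⱼ⟩` for a Hilbert-Schmidt self-adjoint operator `S` and any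
two orthonormal bases `e` and `b`. -/
theorem hasSum_inner_comp_sq_of_basis {ι κ : Type*} (e : HilbertBasis ι ℂ H)
    (b : HilbertBasis κ ℂ H) (T : H →L[ℂ] H) {S : H →L[ℂ] H} (hS : IsSelfAdjoint S)
    (he : Summable fun i => ‖S (e i)‖ ^ 2) (hb : Summable fun j => ‖S (b j)‖ ^ 2) :
    HasSum (fun i => inner ℂ (e i) (T (S (S (e i)))))
      (∑' j, inner ℂ (S (b j)) (T (S (b j)))) := by
  have hsym : ∀ x y : H, inner ℂ (S x) y = inner ℂ x (S y) := fun x y =>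
    (ContinuousLinearMap.isSelfAdjoint_iff_isSymmetric.1 hS) x y
  have a1 : Summable fun p : ι × κ => ‖inner ℂ (b p.2) (S (e p.1))‖ ^ 2 := by
    refine (summable_prod_of_nonneg fun _ => by positivity).2
      ⟨fun i => (hasSum_norm_sq_inner b (S (e i))).summable, ?_⟩
    simpa only [fun i => (hasSum_norm_sq_inner b (S (e i))).tsum_eq] using he
  have a2 : Summable fun p : ι × κ => ‖inner ℂ (e p.1) (T (S (b p.2)))‖ ^ 2 := by
    have : Summable fun p : κ × ι => ‖inner ℂ (e p.2) (T (S (b p.1)))‖ ^ 2 := by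
      refine (summable_prod_of_nonneg fun _ => by positivity).2
        ⟨fun i => (hasSum_norm_sq_inner e (T (S (b i)))).summable, ?_⟩
      simp only [fun i => (hasSum_norm_sq_inner e (T (S (b i)))).tsum_eq]
      refine Summable.of_nonneg_of_le (fun _ => by positivity) (fun i => ?_)
        (hb.mul_left (‖T‖ ^ 2))
      rw [← mul_pow]
      exact pow_le_pow_left₀ (norm_nonneg _) (T.le_opNorm _) 2
    exact this.prod_symm
  -- The matrix entries of `S` and of `T S` between the two bases are square summable by Parseval,
  -- so their products are absolutely summable and both orders of summation agree.
  have hF : Summable fun p : ι × κ =>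
      inner ℂ (b p.2) (S (e p.1)) * inner ℂ (e p.1) (T (S (b p.2))) := by
    refine Summable.of_norm_bounded (a1.add a2) fun p => ?_
    rw [norm_mul]
    nlinarith [sq_nonneg (‖inner ℂ (b p.2) (S (e p.1))‖ - ‖inner ℂ (e p.1) (T (S (b p.2)))‖),
      sq_nonneg ‖inner ℂ (b p.2) (S (e p.1))‖, sq_nonneg ‖inner ℂ (e p.1) (T (S (b p.2)))‖]
  -- Row sums: expand `S eᵢ` in the basis `b` and apply `⟨eᵢ, T S ·⟩`.
  have f1 : ∀ i, HasSum (fun j => inner ℂ (b j) (S (e i)) * inner ℂ (e i) (T (S (b j))))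
      (inner ℂ (e i) (T (S (S (e i))))) := by
    intro i
    have := (b.hasSum_repr (S (e i))).mapL ((innerSL ℂ (e i)).comp (T.comp S))
    simpa [b.repr_apply_apply, inner_smul_right] using this
  -- Column sums: move `S` onto `bⱼ` and apply Parseval in the basis `e`.
  have f2 : ∀ j, HasSum (fun i => inner ℂ (b j) (S (e i)) * inner ℂ (e i) (T (S (b j))))
      (inner ℂ (S (b j)) (T (S (b j)))) := by
    intro j
    simpa only [hsym] using e.hasSum_inner_mul_inner (S (b j)) (T (S (b j)))
  have g1 := hF.hasSum.prod_fiberwise f1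
  have g2 := ((Equiv.prodComm κ ι).hasSum_iff.2 hF.hasSum).prod_fiberwise f2
  rw [g2.tsum_eq]
  exact g1

namespace PartialDensity

/-- Cyclicity, `tr(T S²) = tr(S T S)` with `S = √f`. It expresses the trace through values `⟨x, T
x⟩` of the quadratic form, which is how `A_r` is specified. -/
theorem trace_comp (f : PartialDensity H) (T : H →L[ℂ] H) :
    trace (T ∘L f.op) =
      ∑' j, inner ℂ (f.root (stdBasis H j)) (T (f.root (stdBasis H j))) := by
  have h := (hasSum_inner_comp_sq (stdBasis H) T f.root_selfAdjoint (f.summable_root _)).tsum_eq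
  rw [trace, ← h]
  simp only [ContinuousLinearMap.comp_apply, f.root_root]

/-- The trace of `T f` may be computed in any orthonormal basis. -/
theorem hasSum_trace_comp (f : PartialDensity H) (T : H →L[ℂ] H) {ι : Type*}
    (e : HilbertBasis ι ℂ H) :
    HasSum (fun i => inner ℂ (e i) ((T ∘L f.op) (e i))) (trace (T ∘L f.op)) := by
  have h := hasSum_inner_comp_sq_of_basis e (stdBasis H) T f.root_selfAdjoint
    (f.summable_root _) (f.summable_root _)
  simp only [f.root_root] at h
  rwa [f.trace_comp]

end PartialDensity

/-! ### Trace class property of `T f`. -/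

open scoped ComplexOrder in
/-- `|T S| ≤ ‖T‖ S` for positive `S`. -/
theorem abs_comp_le (T : H →L[ℂ] H) {S : H →L[ℂ] H} (hS : 0 ≤ S) :
    CFC.abs (T ∘L S) ≤ (‖T‖ : ℂ) • S := by
  have hT : (0 : ℂ) ≤ (‖T‖ : ℂ) := by exact_mod_cast norm_nonneg T
  have hc : 0 ≤ (‖T‖ : ℂ) • S := by
    rw [ContinuousLinearMap.nonneg_iff_isPositive] at hS ⊢
    exact hS.smul_of_nonneg hT
  -- With both sides written as square roots, operator monotonicity reduces the claim to `(T S)* (T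
  -- S) ≤ (‖T‖ S)²`, which on vectors says `‖T S x‖ ≤ ‖T‖ ‖S x‖`.
  rw [CFC.abs, ← CFC.sqrt_mul_self _ hc]
  refine CFC.sqrt_le_sqrt _ _ ?_
  have hs : star ((‖T‖ : ℂ) • S) = (‖T‖ : ℂ) • S := (IsSelfAdjoint.of_nonneg hc).star_eq
  have hn : ∀ (R : H →L[ℂ] H) (x : H), (star R * R).reApplyInnerSelf x = ‖R x‖ ^ 2 := by
    intro R x
    change RCLike.re (inner ℂ ((ContinuousLinearMap.adjoint R) (R x)) x) = _
    rw [ContinuousLinearMap.adjoint_inner_left, inner_self_eq_norm_sq]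
  -- The right-hand square takes the form `star R * R`, so that `hn` applies to both sides.
  nth_rewrite 1 [← hs]
  rw [ContinuousLinearMap.le_def, ContinuousLinearMap.isPositive_def']
  refine ⟨(IsSelfAdjoint.star_mul_self _).sub (IsSelfAdjoint.star_mul_self _), fun x => ?_⟩
  have hx : (star ((‖T‖ : ℂ) • S) * ((‖T‖ : ℂ) • S) - star (T ∘L S) * (T ∘L S)).reApplyInnerSelf x
      = ‖((‖T‖ : ℂ) • S) x‖ ^ 2 - ‖(T ∘L S) x‖ ^ 2 := by
    rw [← hn, ← hn]
    simp only [ContinuousLinearMap.reApplyInnerSelf_apply, sub_apply, inner_sub_left, map_sub]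
  rw [hx, sub_nonneg]
  refine pow_le_pow_left₀ (norm_nonneg _) ?_ 2
  rw [smul_apply, norm_smul, Complex.norm_real, norm_norm]
  exact T.le_opNorm _

/-- The diagonal entries of `|T f|` are dominated by `‖T‖` times those of `f`, namely `‖T‖ ‖√f
bᵢ‖²`. -/
theorem PartialDensity.isTraceClass_comp (f : PartialDensity H) (T : H →L[ℂ] H) :
    IsTraceClass (T ∘L f.op) := by
  refine ⟨basisIndex H, stdBasis H, Summable.of_nonneg_of_le (fun i => ?_) (fun i => ?_)
    ((f.summable_root (stdBasis H)).mul_left ‖T‖)⟩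
  · exact ((ContinuousLinearMap.nonneg_iff_isPositive _).1
      (CFC.abs_nonneg (T ∘L f.op))).re_inner_nonneg_right _
  · have h := (ContinuousLinearMap.le_def _ _).1 (abs_comp_le T f.nonneg)
    have h1 := h.re_inner_nonneg_right (stdBasis H i)
    simp only [sub_apply, smul_apply, inner_sub_right, inner_smul_right, f.inner_op, map_sub] at h1
    simpa [← Complex.ofReal_mul, ← Complex.ofReal_pow, -Complex.ofReal_mul, -Complex.ofReal_pow]
      using h1

/-! ### The expected value as a trace. -/

theorem Observable.expect₀_toPartialState (r : Observable H) (hr : r.IsBounded)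
    (f : PartialDensity H) :
    ((r.expect₀ f.toPartialState : ℝ) : ℂ) = trace (r.operator hr ∘L f.op) := by
  have hint := r.integrable_id_distribution hr f.toPartialState
  rw [r.expect₀_eq_integral hr, f.trace_comp]
  rw [r.distribution_toPartialState] at hint ⊢
  -- Integrability against the sum measure allows term-by-term integration; the terms then match by
  -- the defining property of `A_r` at `√f bⱼ`.
  rw [← (hasSum_integral_measure hint).tsum_eq, Complex.ofReal_tsum]
  exact tsum_congr fun j => (((r.operator_spec hr).2 _).2).symm

end QuantumLogic

theorem mainTheorem6 {H : Type*} [NormedAddCommGroup H] [InnerProductSpace ℂ H]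
    [CompleteSpace H] [TopologicalSpace.SeparableSpace H]
    (r : QuantumLogic.Observable H) (hr : r.IsBounded) (f : QuantumLogic.PartialDensity H) :
    (IntegrableOn (fun t : ℝ => t) (Set.Icc r.lower r.upper)
        (r.distribution f.toPartialState) ∧
      QuantumLogic.IsTraceClass (r.operator hr ∘L f.op) ∧
      (∀ {ι : Type*} (e : HilbertBasis ι ℂ H),
        HasSum (fun i => inner ℂ (e i) ((r.operator hr ∘L f.op) (e i)))
          (QuantumLogic.trace (r.operator hr ∘L f.op))) ∧
      ((r.expect₀ f.toPartialState : ℝ) : ℂ) = QuantumLogic.trace (r.operator hr ∘L f.op)) ∧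
    r.expect f.toPartialState =
      {(QuantumLogic.trace (r.operator hr ∘L f.op)).re} +
        (1 - (QuantumLogic.trace f.op).re) • Set.Icc r.lower r.upper := by
  have h := r.expect₀_toPartialState hr f
  refine ⟨⟨(r.integrable_id_distribution hr _).integrableOn, f.isTraceClass_comp _,
    fun e => f.hasSum_trace_comp _ e, h⟩, ?_⟩
  -- By `h` the trace is a real number, so taking its real part loses nothing.
  rw [QuantumLogic.Observable.expect, r.distribution_toPartialState_univ, ← h, Complex.ofReal_re]
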